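/- Let $m,T,N,r$ be natural numbers, $M=\max(m,T)$, $r\le\min(m,T)$, and let $\kappa\in(0,1]$ satisfy $\kappa Mr\ge 8$. Consider the observations $$Y_k=\operatorname{tr}(X_k'A^*)+\xi_k,\qquad k=1,\dots,N,$$ where $A^*\in\mathbb R^{m\times T}$ is unknown, $\xi_1,\dots,\xi_N$ are i.i.d. $\mathcal N(0,\sigma^2)$ random variables with $\sigma^2>0$, and the masks $X_k=e_{i_k}(m)e_{j_k}'(T)$, $k=1,\dots,N$ (where $e_i(m)$ denotes the $i$th canonical basis vector of $\mathbb R^m$), are nonrandom and pairwise different. Let $\mathbb P_A$ be the distribution of $(Y_1,\dots,Y_N)$ when $A^*=A$, and let $$\hat d_{2,N}(A,B)^2=\frac1N\sum_{k=1}^N\operatorname{tr}^2\bigl(X_k'(A-B)\bigr).$$ Assume the dispersion condition: there exist $1\le k_1<\dots<k_r\le T$ such that $\{(i_1,j_1),\dots,(i_N,j_N)\}\cap\{(i,k_1),\dots,(i,k_r): i=1,\dots,m\}$ has cardinality at least $\kappa Mr+1$, or there exist $1\le k_1'<\dots<k_r'\le m$ such that $\{(i_1,j_1),\dots,(i_N,j_N)\}\cap\{(k_1',j),\dots,(k_r',j):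 j=1,\dots,T\}$ has cardinality at least $\kappa Mr+1$. For $\delta>0$ let $$\mathcal C_{\delta,r}=\{A\in\mathbb R^{m\times T}:\ \operatorname{rank}(A)\le r,\ \|A\|_{S_2}\le\delta\},$$ where $\|\cdot\|_{S_2}$ is the Frobenius norm. Then for every $0<\alpha<1/8$ and every $\delta>0$ with $\delta^2\ge\alpha\sigma^2(\log 2)(\kappa Mr+1)/4$, $$\inf_{\hat A}\ \sup_{A^*\in\mathcal C_{\delta,r}}\mathbb P_{A^*}\Bigl(\hat d_{2,N}(\hat A,A^*)^2> C'(\alpha)\,\frac{\sigma^2\kappa rM}{N}\Bigr)\ \ge\ \beta(\kappa M,\alpha)>0,\qquad C'(\alpha)=\frac{\alpha\log 2}{128},$$ where the infimum is over all estimators, i.e. all measurable functions $\hat A$ of $(Y_1,\dots,Y_N)$ with values in $\mathbb R^{m\times T}$ (which may depend on the known masks), and $\beta:(0,\infty)\times(0,1/8)\to(0,\infty)$ is a universal function (independent of $m,T,N,r,\kappa,\sigma,\delta$ and the masks) with $\beta(x,\alpha)\to1$ as $x\to\infty$, $\alpha\to0$. -/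

import Mathlib

open MeasureTheory ProbabilityTheory Filter Topology
open scoped NNReal ENNReal

noncomputable section

namespace TraceRegression

/-- The squared prediction error `N⁻¹ ∑ₖ tr²(Xₖ' (A - B))`. -/
def predErrorSq {N m T : ℕ} (X : Fin N → Matrix (Fin m) (Fin T) ℝ)
    (A B : Matrix (Fin m) (Fin T) ℝ) : ℝ :=
  (N : ℝ)⁻¹ * ∑ k, (((X k).transpose * (A - B)).trace) ^ 2

/-- The observations `Yₖ = tr(Xₖ' A) + ξₖ` of the trace regression model with noise `ξ`. -/
def observations {N m T : ℕ} {Ω : Type*} (X : Fin N → Matrix (Fin m) (Fin T) ℝ)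
    (ξ : Fin N → Ω → ℝ) (A : Matrix (Fin m) (Fin T) ℝ) (ω : Ω) : Fin N → ℝ :=
  fun k => ((X k).transpose * A).trace + ξ k ω

/-- The distribution of `(Y₁, …, Y_N)` when the unknown matrix is `A`. -/
def obsLaw {N m T : ℕ} {Ω : Type*} [MeasurableSpace Ω] (P : Measure Ω)
    (X : Fin N → Matrix (Fin m) (Fin T) ℝ) (ξ : Fin N → Ω → ℝ)
    (A : Matrix (Fin m) (Fin T) ℝ) : Measure (Fin N → ℝ) :=
  P.map (observations X ξ A)

/-- The mask `e_i(m) e_j(T)'` of the entry `p = (i, j)`. -/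
def pointMask {m T : ℕ} (p : Fin m × Fin T) : Matrix (Fin m) (Fin T) ℝ :=
  Matrix.single p.1 p.2 1

/-- The set of observed entries `{(i₁, j₁), …, (i_N, j_N)}`. -/
def observed {N m T : ℕ} (e : Fin N → Fin m × Fin T) : Finset (Fin m × Fin T) :=
  Finset.univ.image e

/-- Some `r` columns or some `r` rows contain at least `κ max(m,T) r + 1` observed entries. -/
def Dispersed {N m T : ℕ} (κ : ℝ) (r : ℕ) (e : Fin N → Fin m × Fin T) : Prop :=
  (∃ J : Finset (Fin T), J.card = r ∧
    κ * (max m T : ℕ) * r + 1 ≤ (((observed e).filter (fun p => p.2 ∈ J)).card : ℝ)) ∨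
  (∃ I : Finset (Fin m), I.card = r ∧
    κ * (max m T : ℕ) * r + 1 ≤ (((observed e).filter (fun p => p.1 ∈ I)).card : ℝ))

section Frobenius

open scoped Matrix.Norms.Frobenius

/-- Matrices of rank at most `r` and Frobenius (Schatten-2) norm at most `δ`. -/
def lowRankBall (m T r : ℕ) (δ : ℝ) : Set (Matrix (Fin m) (Fin T) ℝ) :=
  {A | A.rank ≤ r ∧ ‖A‖ ≤ δ}

end Frobenius

/-- Minimax probability that the squared prediction error exceeds `t`, over the class `C` of
unknown matrices: the infimum runs over all estimators, i.e. all (entrywise) measurable functions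
of the observations (the masks are nonrandom). -/
def minimaxExceedance {N m T : ℕ} {Ω : Type*} [MeasurableSpace Ω] (P : Measure Ω)
    (X : Fin N → Matrix (Fin m) (Fin T) ℝ) (ξ : Fin N → Ω → ℝ)
    (C : Set (Matrix (Fin m) (Fin T) ℝ)) (t : ℝ) : ℝ≥0∞ :=
  ⨅ (Ahat : (Fin N → ℝ) → Matrix (Fin m) (Fin T) ℝ)
    (_ : ∀ i j, Measurable (fun y => Ahat y i j)),
    ⨆ A ∈ C, obsLaw P X ξ A {y | t < predErrorSq X (Ahat y) A}

end TraceRegression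

end

/-! ### Averaging over a hypercube of product measures -/

/-- The lower Lebesgue integral of a product of functions of separate coordinates. -/
lemma lintegral_pi_prod {ι E : Type*} [Fintype ι] [MeasurableSpace E]
    (ν : ι → Measure E) [∀ k, IsProbabilityMeasure (ν k)] {f : ι → E → ℝ≥0∞}
    (hf : ∀ k, Measurable (f k)) :
    ∫⁻ y, ∏ k, f k (y k) ∂(Measure.pi ν) = ∏ k, ∫⁻ x, f k x ∂(ν k) := by
  have hind : iIndepFun (fun k (y : ι → E) => f k (y k)) (Measure.pi ν) :=
    iIndepFun_pi (μ := ν) (X := f) fun k => (hf k).aemeasurable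
  rw [lintegral_prod_eq_prod_lintegral_of_indepFun Finset.univ _ hind
    (fun k => (hf k).comp (measurable_pi_apply k))]
  refine Finset.prod_congr rfl fun k _ => ?_
  exact (measurePreserving_eval ν k).lintegral_comp (hf k)

/-- A product of measures with densities has the product density. -/
lemma pi_withDensity_eq {ι E : Type*} [Fintype ι] [MeasurableSpace E]
    (ν : ι → Measure E) [∀ k, IsProbabilityMeasure (ν k)] {f : ι → E → ℝ≥0∞}
    (hf : ∀ k, Measurable (f k)) (h1 : ∀ k, ∫⁻ x, f k x ∂(ν k) = 1) :
    Measure.pi (fun k => (ν k).withDensity (f k)) =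
      (Measure.pi ν).withDensity (fun y => ∏ k, f k (y k)) := by
  have hp : ∀ k, IsProbabilityMeasure ((ν k).withDensity (f k)) := fun k =>
    ⟨by rw [withDensity_apply _ MeasurableSet.univ, setLIntegral_univ, h1]⟩
  refine Measure.pi_eq fun s hs => ?_
  rw [withDensity_apply _ (MeasurableSet.univ_pi hs),
    ← lintegral_indicator (MeasurableSet.univ_pi hs)]
  have hind : (Set.univ.pi s).indicator (fun y : ι → E => ∏ k, f k (y k)) =
      fun y => ∏ k, (s k).indicator (f k) (y k) := by
    classical
    funext y
    by_cases hy : y ∈ Set.univ.pi s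
    · rw [Set.indicator_of_mem hy]
      exact Finset.prod_congr rfl fun k _ =>
        (Set.indicator_of_mem (hy k (Set.mem_univ k)) _).symm
    · rw [Set.indicator_of_notMem hy]
      obtain ⟨k, hk⟩ : ∃ k, y k ∉ s k := by simpa [Set.mem_pi] using hy
      exact (Finset.prod_eq_zero (Finset.mem_univ k) (Set.indicator_of_notMem hk _)).symm
  rw [hind, lintegral_pi_prod ν fun k => (hf k).indicator (hs k)]
  refine Finset.prod_congr rfl fun k _ => ?_
  rw [lintegral_indicator (hs k), withDensity_apply _ (hs k)]

/-- The total weight of the vertices of the hypercube that lie close, in the Hamming distance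
restricted to `S`, to a given vertex `w`. -/
lemma sum_prod_near_le {ι : Type*} [Fintype ι] [DecidableEq ι] (S : Finset ι)
    (w : ι → Bool) (p : ι → Bool → ℝ≥0∞) {K a q ρ : ℝ≥0∞} {n : ℕ}
    (hp : ∀ k b, p k b ≤ K) (haq : a + q = 1) (hρ : 1 ≤ ρ) (hq : 1 ≤ q * ρ ^ n) :
    ∑ ω : ι → Bool, (if n * (S.filter fun k => ω k ≠ w k).card ≤ S.card then
        ∏ k, p k (ω k) else 0) ≤
      ρ ^ S.card *
        ∏ k, (if k ∈ S then a * K + q * (p k true + p k false) else p k true + p k false) := by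
  let W : ι → Bool → ℝ≥0∞ := fun k b => if k ∈ S ∧ b ≠ w k then q else 1
  have hterm : ∀ ω : ι → Bool,
      (if n * (S.filter fun k => ω k ≠ w k).card ≤ S.card then ∏ k, p k (ω k) else 0) ≤
        ρ ^ S.card * ∏ k, (W k (ω k) * p k (ω k)) := by
    intro ω
    split_ifs with h
    · have hW : ∏ k, W k (ω k) = q ^ (S.filter fun k => ω k ≠ w k).card := by
        rw [← Finset.prod_const, Finset.prod_filter]
        simp only [W, ite_and]
        rw [Finset.prod_ite_mem]
        simp
      rw [Finset.prod_mul_distrib, hW, ← mul_assoc]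
      refine le_mul_of_one_le_left' ?_
      calc (1 : ℝ≥0∞) ≤ (q * ρ ^ n) ^ (S.filter fun k => ω k ≠ w k).card :=
            one_le_pow_of_one_le' hq _
        _ = ρ ^ (n * (S.filter fun k => ω k ≠ w k).card) *
              q ^ (S.filter fun k => ω k ≠ w k).card := by
            rw [mul_pow, ← pow_mul, mul_comm]
        _ ≤ _ := by gcongr
    · exact zero_le
  refine (Finset.sum_le_sum fun ω _ => hterm ω).trans ?_
  rw [← Finset.mul_sum]
  gcongr
  have hexp := Finset.prod_univ_sum (fun _ : ι => (Finset.univ : Finset Bool))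
    (fun k b => W k b * p k b)
  rw [Fintype.piFinset_univ] at hexp
  rw [← hexp]
  refine Finset.prod_le_prod' fun k _ => ?_
  rw [Fintype.sum_bool]
  have key : ∀ x y : ℝ≥0∞, x ≤ K → x + q * y ≤ a * K + q * (x + y) := fun x y hx =>
    calc x + q * y = (a + q) * x + q * y := by rw [haq, one_mul]
      _ = a * x + q * (x + y) := by ring
      _ ≤ _ := by gcongr
  by_cases hk : k ∈ S
  · cases hw : w k
    · have := key _ (p k true) (hp k false)
      simpa [W, hk, hw, add_comm] using this
    · have := key _ (p k false) (hp k true)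
      simpa [W, hk, hw] using this
  · simp [W, hk]

/-- No decision rule `w` can identify most of the bits of a random vertex of the hypercube from an
observation whose coordinates are independent, given the vertex, with densities bounded by `K`. -/
lemma sum_pi_near_le {ι E : Type*} [Fintype ι] [DecidableEq ι] [MeasurableSpace E]
    (ν : Measure E) [IsProbabilityMeasure ν] (S : Finset ι) {f : ι → Bool → E → ℝ≥0∞}
    (hf : ∀ k b, Measurable (f k b)) (h1 : ∀ k b, ∫⁻ x, f k b x ∂ν = 1)
    {K a q ρ : ℝ≥0∞} {n : ℕ} (hK : ∀ k b x, f k b x ≤ K) (haq : a + q = 1) (hρ : 1 ≤ ρ)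
    (hq : 1 ≤ q * ρ ^ n) (w : (ι → E) → ι → Bool) (D : (ι → Bool) → Set (ι → E))
    (hD : ∀ ω, MeasurableSet (D ω))
    (hDw : ∀ ω, ∀ y ∈ D ω, n * (S.filter fun k => ω k ≠ w y k).card ≤ S.card) :
    ∑ ω, Measure.pi (fun k => ν.withDensity (f k (ω k))) (D ω) ≤
      ρ ^ S.card * ∏ k : ι, (if k ∈ S then a * K + q * 2 else 2) := by
  have hmeas : ∀ ω : ι → Bool, Measurable fun y : ι → E => ∏ k, f k (ω k) (y k) := fun ω =>
    Finset.measurable_fun_prod _ fun k _ => (hf k (ω k)).comp (measurable_pi_apply k)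
  let g : ι → E → ℝ≥0∞ := fun k x =>
    if k ∈ S then a * K + q * (f k true x + f k false x) else f k true x + f k false x
  have hg : ∀ k, Measurable (g k) := by
    intro k
    have := hf k true
    have := hf k false
    by_cases hk : k ∈ S
    · simp only [g, hk, if_true]; fun_prop
    · simp only [g, hk, if_false]; fun_prop
  have hgint : ∀ k, ∫⁻ x, g k x ∂ν = if k ∈ S then a * K + q * 2 else 2 := by
    intro k
    have hadd : ∫⁻ x, (f k true x + f k false x) ∂ν = 2 := by
      rw [lintegral_add_left (hf k true), h1, h1, one_add_one_eq_two]
    by_cases hk : k ∈ S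
    · simp only [g, hk, if_true]
      rw [lintegral_add_left measurable_const,
        lintegral_const_mul _ (f := fun x => f k true x + f k false x)
          ((hf k true).add (hf k false)), hadd]
      simp
    · simpa only [g, hk, if_false] using hadd
  calc ∑ ω, Measure.pi (fun k => ν.withDensity (f k (ω k))) (D ω)
      = ∑ ω, ∫⁻ y, (D ω).indicator (fun y => ∏ k, f k (ω k) (y k)) y
          ∂(Measure.pi fun _ => ν) := by
        refine Finset.sum_congr rfl fun ω _ => ?_
        rw [pi_withDensity_eq (fun _ => ν) (fun k => hf k (ω k)) (fun k => h1 k (ω k)),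
          withDensity_apply _ (hD ω), lintegral_indicator (hD ω)]
    _ = ∫⁻ y, ∑ ω, (D ω).indicator (fun y => ∏ k, f k (ω k) (y k)) y
          ∂(Measure.pi fun _ => ν) :=
        (lintegral_finsetSum _ fun ω _ => (hmeas ω).indicator (hD ω)).symm
    _ ≤ ∫⁻ y, ρ ^ S.card * ∏ k, g k (y k) ∂(Measure.pi fun _ => ν) := by
        refine lintegral_mono fun y => ?_
        refine le_trans (Finset.sum_le_sum fun ω _ => ?_)
          (sum_prod_near_le S (w y) (fun k b => f k b (y k)) (fun k b => hK k b (y k))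
            haq hρ hq)
        by_cases hy : y ∈ D ω
        · rw [Set.indicator_of_mem hy, if_pos (hDw ω y hy)]
        · rw [Set.indicator_of_notMem hy]; exact zero_le
    _ = _ := by
        rw [lintegral_const_mul _ (f := fun y : ι → E => ∏ k, g k (y k))
          (Finset.measurable_fun_prod _ fun k _ => (hg k).comp (measurable_pi_apply k)),
          lintegral_pi_prod (fun _ => ν) hg]
        simp only [hgint]

/-! ### Gaussian envelope -/

/-- Gaussian densities with small mean lie below a multiple of a centred Gaussian density with a
larger variance. -/
lemma gaussianPDFReal_le_envelope {v : ℝ≥0} (hv : 0 < v) {b : ℝ} (hb : b ^ 2 ≤ v / 40) (x : ℝ) :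
    gaussianPDFReal b v x ≤ 5 / 4 * gaussianPDFReal 0 (36 / 25 * v) x := by
  have hv' : (0 : ℝ) < v := hv
  have hsqrt : √(2 * Real.pi * ((36 / 25 * v : ℝ≥0) : ℝ)) = 6 / 5 * √(2 * Real.pi * v) := by
    have : 2 * Real.pi * ((36 / 25 * v : ℝ≥0) : ℝ) = (6 / 5) ^ 2 * (2 * Real.pi * v) := by
      push_cast; ring
    rw [this, Real.sqrt_mul (by positivity), Real.sqrt_sq (by norm_num)]
  have hexp : Real.exp (1 / 25) ≤ 25 / 24 := by
    have h := Real.add_one_le_exp (-(1 / 25) : ℝ)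
    rw [Real.exp_neg] at h
    have hpos := Real.exp_pos (1 / 25)
    have h2 : (24 / 25 : ℝ) ≤ (Real.exp (1 / 25))⁻¹ := by linarith
    rw [le_inv_comm₀ (by norm_num) hpos] at h2
    linarith
  have hquad : -(x - b) ^ 2 / (2 * v) ≤
      1 / 25 + -(x - 0) ^ 2 / (2 * ((36 / 25 * v : ℝ≥0) : ℝ)) := by
    push_cast
    rw [← sub_nonneg]
    have : 1 / 25 + -(x - 0) ^ 2 / (2 * (36 / 25 * (v : ℝ))) - -(x - b) ^ 2 / (2 * v) =
        (72 * v / 25 - 25 * x ^ 2 + 36 * (x - b) ^ 2) / (72 * v) := by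
      field_simp; ring
    rw [this]
    refine div_nonneg ?_ (by positivity)
    nlinarith [sq_nonneg (11 * x - 36 * b)]
  simp only [gaussianPDFReal, hsqrt, mul_inv]
  calc (√(2 * Real.pi * v))⁻¹ * Real.exp (-(x - b) ^ 2 / (2 * v))
      ≤ (√(2 * Real.pi * v))⁻¹ *
          (25 / 24 * Real.exp (-(x - 0) ^ 2 / (2 * ((36 / 25 * v : ℝ≥0) : ℝ)))) := by
        gcongr
        refine (Real.exp_le_exp.2 hquad).trans ?_
        rw [Real.exp_add]
        gcongr
    _ = _ := by ring

/-- The density of `gaussianReal b v` with respect to a wider centred Gaussian. -/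
noncomputable def envelopeDensity (v : ℝ≥0) (b x : ℝ) : ℝ≥0∞ :=
  gaussianPDF b v x / gaussianPDF 0 (36 / 25 * v) x

lemma measurable_envelopeDensity (v : ℝ≥0) (b : ℝ) : Measurable (envelopeDensity v b) :=
  (measurable_gaussianPDF b v).div (measurable_gaussianPDF 0 _)

lemma withDensity_envelopeDensity {v : ℝ≥0} (hv : 0 < v) (b : ℝ) :
    (gaussianReal 0 (36 / 25 * v)).withDensity (envelopeDensity v b) = gaussianReal b v := by
  have hv' : (36 / 25 * v : ℝ≥0) ≠ 0 := by positivity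
  rw [gaussianReal_of_var_ne_zero _ hv', gaussianReal_of_var_ne_zero _ hv.ne',
    ← withDensity_mul _ (measurable_gaussianPDF 0 _) (measurable_envelopeDensity v b)]
  congr 1
  funext x
  exact ENNReal.mul_div_cancel (gaussianPDF_pos 0 hv' x).ne' gaussianPDF_ne_top

lemma lintegral_envelopeDensity {v : ℝ≥0} (hv : 0 < v) (b : ℝ) :
    ∫⁻ x, envelopeDensity v b x ∂(gaussianReal 0 (36 / 25 * v)) = 1 := by
  rw [← setLIntegral_univ, ← withDensity_apply _ MeasurableSet.univ,
    withDensity_envelopeDensity hv, measure_univ]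

lemma envelopeDensity_le {v : ℝ≥0} (hv : 0 < v) {b : ℝ} (hb : b ^ 2 ≤ v / 40) (x : ℝ) :
    envelopeDensity v b x ≤ ENNReal.ofReal (5 / 4) := by
  refine ENNReal.div_le_of_le_mul ?_
  rw [gaussianPDF, gaussianPDF, ← ENNReal.ofReal_mul (by norm_num)]
  exact ENNReal.ofReal_le_ofReal (gaussianPDFReal_le_envelope hv hb x)

/-- Decoding the bits of a hypercube of Gaussian product measures with small means: on average,
the probability of at most `#S / 32` errors on `S` is at most `(3 / 4) ^ #S`. -/
lemma sum_pi_gaussianReal_near_le {ι : Type*} [Fintype ι] [DecidableEq ι] (S : Finset ι)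
    {v : ℝ≥0} (hv : 0 < v) (b : ι → Bool → ℝ) (hb : ∀ k c, b k c ^ 2 ≤ v / 40)
    (w : (ι → ℝ) → ι → Bool) (D : (ι → Bool) → Set (ι → ℝ)) (hD : ∀ ω, MeasurableSet (D ω))
    (hDw : ∀ ω, ∀ y ∈ D ω, 32 * (S.filter fun k => ω k ≠ w y k).card ≤ S.card) :
    ∑ ω, Measure.pi (fun k => gaussianReal (b k (ω k)) v) (D ω) ≤
      2 ^ Fintype.card ι * ENNReal.ofReal (3 / 4) ^ S.card := by
  have h := sum_pi_near_le (gaussianReal 0 (36 / 25 * v)) S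
    (f := fun k c => envelopeDensity v (b k c)) (K := ENNReal.ofReal (5 / 4))
    (a := ENNReal.ofReal (15 / 16)) (q := ENNReal.ofReal (1 / 16))
    (ρ := ENNReal.ofReal (11 / 10)) (n := 32)
    (fun k c => measurable_envelopeDensity v _) (fun k c => lintegral_envelopeDensity hv _)
    (fun k c x => envelopeDensity_le hv (hb k c) x)
    (by rw [← ENNReal.ofReal_add (by norm_num) (by norm_num)]; norm_num)
    (by rw [← ENNReal.ofReal_one]; exact ENNReal.ofReal_le_ofReal (by norm_num))
    (by
      rw [← ENNReal.ofReal_pow (by norm_num), ← ENNReal.ofReal_mul (by norm_num),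
        ← ENNReal.ofReal_one]
      exact ENNReal.ofReal_le_ofReal (by norm_num))
    w D hD hDw
  simp only [withDensity_envelopeDensity hv] at h
  refine h.trans ?_
  have hfac : ENNReal.ofReal (15 / 16) * ENNReal.ofReal (5 / 4) + ENNReal.ofReal (1 / 16) * 2 ≤
      2 * ENNReal.ofReal (83 / 128) := by
    have h2 : (2 : ℝ≥0∞) = ENNReal.ofReal 2 := by simp
    rw [h2, ← ENNReal.ofReal_mul (by norm_num), ← ENNReal.ofReal_mul (by norm_num),
      ← ENNReal.ofReal_mul (by norm_num), ← ENNReal.ofReal_add (by norm_num) (by norm_num)]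
    exact ENNReal.ofReal_le_ofReal (by norm_num)
  calc _ ≤ ENNReal.ofReal (11 / 10) ^ S.card *
        ∏ k : ι, (2 * if k ∈ S then ENNReal.ofReal (83 / 128) else 1) := by
        gcongr with k
        split_ifs
        · exact hfac
        · simp
    _ = 2 ^ Fintype.card ι *
          (ENNReal.ofReal (11 / 10) * ENNReal.ofReal (83 / 128)) ^ S.card := by
        rw [Finset.prod_mul_distrib, Finset.prod_ite_mem]
        simp only [Finset.prod_const, Finset.univ_inter, Finset.card_univ, mul_pow]
        ring
    _ ≤ _ := by
        rw [← ENNReal.ofReal_mul (by norm_num)]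
        gcongr
        norm_num

/-! ### The trace regression model with point masks -/

namespace TraceRegression

lemma trace_pointMask_transpose_mul {m T : ℕ} (p : Fin m × Fin T)
    (A : Matrix (Fin m) (Fin T) ℝ) :
    ((pointMask p).transpose * A).trace = A p.1 p.2 := by
  simp [pointMask, Matrix.transpose_single, Matrix.trace_single_mul]

/-- For point masks and Gaussian noise, the observations are independent Gaussian variables. -/
lemma obsLaw_pointMask {N m T : ℕ} {Ω : Type*} [MeasurableSpace Ω] {P : Measure Ω}
    [IsProbabilityMeasure P] {v : ℝ≥0} {ξ : Fin N → Ω → ℝ} (e : Fin N → Fin m × Fin T)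
    (hξ : ∀ k, HasLaw (ξ k) (gaussianReal 0 v) P) (hind : iIndepFun ξ P)
    (A : Matrix (Fin m) (Fin T) ℝ) :
    obsLaw P (fun k => pointMask (e k)) ξ A =
      Measure.pi fun k => gaussianReal (A (e k).1 (e k).2) v := by
  have hlaw : ∀ k, HasLaw (fun ω => A (e k).1 (e k).2 + ξ k ω)
      (gaussianReal (A (e k).1 (e k).2) v) P := fun k => by
    simpa using gaussianReal_const_add (hξ k) (A (e k).1 (e k).2)
  have hind' : iIndepFun (fun k ω => A (e k).1 (e k).2 + ξ k ω) P :=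
    hind.comp (fun k x => A (e k).1 (e k).2 + x) fun k => by fun_prop
  have hobs : observations (fun k => pointMask (e k)) ξ A =
      fun ω k => A (e k).1 (e k).2 + ξ k ω := by
    funext ω k
    simp only [observations, trace_pointMask_transpose_mul]
  rw [obsLaw, hobs, hind'.map_fun_eq_pi_map fun k => (hlaw k).aemeasurable]
  simp only [(hlaw _).map_eq]

/-- A matrix whose nonzero columns are indexed by `J` has rank at most `#J`. -/
lemma rank_le_card_of_columns {m T : ℕ} (A : Matrix (Fin m) (Fin T) ℝ) (J : Finset (Fin T))
    (h : ∀ i, ∀ j ∉ J, A i j = 0) : A.rank ≤ J.card := by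
  have hA : A = A * Matrix.diagonal (fun j => if j ∈ J then (1 : ℝ) else 0) := by
    ext i j
    rw [Matrix.mul_diagonal]
    by_cases hj : j ∈ J
    · simp [hj]
    · simp [hj, h i j hj]
  rw [hA]
  refine (Matrix.rank_mul_le_right _ _).trans ?_
  rw [Matrix.rank_diagonal, Fintype.card_subtype]
  exact Finset.card_le_card fun j => by simp

lemma rank_le_card_of_rows {m T : ℕ} (A : Matrix (Fin m) (Fin T) ℝ) (I : Finset (Fin m))
    (h : ∀ i ∉ I, ∀ j, A i j = 0) : A.rank ≤ I.card := by
  rw [← Matrix.rank_transpose]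
  exact rank_le_card_of_columns _ I fun j i hi => h i hi j

/-- The matrix with entries `±η` at the positions `e k`, `k ∈ S`, with signs given by `ω`. -/
noncomputable def signMatrix {N m T : ℕ} (e : Fin N → Fin m × Fin T) (S : Finset (Fin N)) (η : ℝ)
    (ω : Fin N → Bool) : Matrix (Fin m) (Fin T) ℝ :=
  Matrix.of fun i j => ∑ k ∈ S, if e k = (i, j) then (if ω k then η else -η) else 0

section signMatrix

variable {N m T : ℕ} {e : Fin N → Fin m × Fin T} {S : Finset (Fin N)} {η : ℝ} {ω : Fin N → Bool}

lemma signMatrix_apply_observed (he : Function.Injective e) (l : Fin N) :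
    signMatrix e S η ω (e l).1 (e l).2 = if l ∈ S then (if ω l then η else -η) else 0 := by
  simp only [signMatrix, Matrix.of_apply, Prod.mk.eta, he.eq_iff]
  exact Finset.sum_ite_eq' S l _

lemma signMatrix_apply_eq_zero {i : Fin m} {j : Fin T} (h : ∀ k ∈ S, e k ≠ (i, j)) :
    signMatrix e S η ω i j = 0 :=
  Finset.sum_eq_zero fun k hk => if_neg (h k hk)

lemma sum_sq_signMatrix (he : Function.Injective e) :
    ∑ i, ∑ j, signMatrix e S η ω i j ^ 2 = S.card * η ^ 2 := by
  rw [← Fintype.sum_prod_type' (f := fun i j => signMatrix e S η ω i j ^ 2)]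
  rw [← Finset.sum_subset (Finset.subset_univ (S.image e)), Finset.sum_image he.injOn]
  · rw [Finset.sum_congr rfl (g := fun _ => η ^ 2)]
    · simp
    · intro k hk
      rw [signMatrix_apply_observed he, if_pos hk]
      split_ifs <;> ring
  · intro p _ hp
    rw [signMatrix_apply_eq_zero, zero_pow two_ne_zero]
    intro k hk hkp
    exact hp (Finset.mem_image.2 ⟨k, hk, hkp⟩)

lemma signMatrix_mem_lowRankBall (he : Function.Injective e) {r : ℕ} {δ : ℝ}
    (hS : (∃ J : Finset (Fin T), J.card = r ∧ ∀ k ∈ S, (e k).2 ∈ J) ∨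
      ∃ I : Finset (Fin m), I.card = r ∧ ∀ k ∈ S, (e k).1 ∈ I)
    (hδ : 0 < δ) (hη : S.card * η ^ 2 ≤ δ ^ 2) :
    signMatrix e S η ω ∈ lowRankBall m T r δ := by
  refine ⟨?_, ?_⟩
  · rcases hS with ⟨J, rfl, hJ⟩ | ⟨I, rfl, hI⟩
    · refine rank_le_card_of_columns _ J fun i j hj => signMatrix_apply_eq_zero ?_
      intro k hk hkp
      exact hj (by simpa [hkp] using hJ k hk)
    · refine rank_le_card_of_rows _ I fun i hi j => signMatrix_apply_eq_zero ?_
      intro k hk hkp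
      exact hi (by simpa [hkp] using hI k hk)
  · rw [Matrix.frobenius_norm_def, ← Real.sqrt_eq_rpow]
    refine Real.sqrt_le_iff.2 ⟨hδ.le, ?_⟩
    have := sum_sq_signMatrix (S := S) (η := η) (ω := ω) he
    simp only [Real.rpow_two, Real.norm_eq_abs, sq_abs]
    rw [this]
    exact hη

/-- Each sign of `signMatrix` that a matrix `B` gets wrong costs `η ^ 2`. -/
lemma card_wrong_sign_le (he : Function.Injective e) (hη : 0 ≤ η)
    (B : Matrix (Fin m) (Fin T) ℝ) :
    ((S.filter fun k => ω k ≠ decide (0 ≤ B (e k).1 (e k).2)).card : ℝ) * η ^ 2 ≤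
      N * predErrorSq (fun k => pointMask (e k)) B (signMatrix e S η ω) := by
  rcases Nat.eq_zero_or_pos N with rfl | hN
  · have : S = ∅ := Finset.eq_empty_of_isEmpty S
    simp [this]
  have hN' : (N : ℝ) ≠ 0 := by positivity
  simp only [predErrorSq, trace_pointMask_transpose_mul, Matrix.sub_apply,
    signMatrix_apply_observed he]
  rw [mul_inv_cancel_left₀ hN', ← nsmul_eq_mul, ← Finset.sum_const]
  refine (Finset.sum_le_sum fun k hk => ?_).trans
    (Finset.sum_le_sum_of_subset_of_nonneg (Finset.subset_univ _) fun k _ _ => sq_nonneg _)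
  obtain ⟨hkS, hk⟩ := Finset.mem_filter.1 hk
  rw [if_pos hkS]
  cases hω : ω k <;> simp [hω] at hk ⊢ <;> nlinarith

end signMatrix

/-- Dispersion provides exactly `⌊κ max(m,T) r⌋ + 1` observations within `r` columns or rows. -/
lemma Dispersed.exists_finset {N m T r : ℕ} {κ : ℝ} {e : Fin N → Fin m × Fin T}
    (h : Dispersed κ r e) (hκ : 0 ≤ κ) (he : Function.Injective e) :
    ∃ S : Finset (Fin N), S.card = ⌊κ * (max m T : ℕ) * r⌋₊ + 1 ∧
      ((∃ J : Finset (Fin T), J.card = r ∧ ∀ k ∈ S, (e k).2 ∈ J) ∨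
        ∃ I : Finset (Fin m), I.card = r ∧ ∀ k ∈ S, (e k).1 ∈ I) := by
  have key : ∀ p : Fin m × Fin T → Prop, ∀ [DecidablePred p],
      κ * (max m T : ℕ) * r + 1 ≤ (((observed e).filter p).card : ℝ) →
      ∃ S : Finset (Fin N), S.card = ⌊κ * (max m T : ℕ) * r⌋₊ + 1 ∧ ∀ k ∈ S, p (e k) := by
    intro p _ hp
    rw [observed, Finset.filter_image, Finset.card_image_of_injective _ he] at hp
    have hle : ⌊κ * (max m T : ℕ) * r⌋₊ + 1 ≤
        (Finset.univ.filter fun k => p (e k)).card := by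
      have := Nat.floor_le (a := κ * (max m T : ℕ) * r) (by positivity)
      exact_mod_cast (add_le_add_left this 1).trans hp
    obtain ⟨S, hS, hc⟩ := Finset.exists_subset_card_eq hle
    exact ⟨S, hc, fun k hk => (Finset.mem_filter.1 (hS hk)).2⟩
  rcases h with ⟨J, hJ, hc⟩ | ⟨I, hI, hc⟩
  · obtain ⟨S, hS, hk⟩ := key (fun p => p.2 ∈ J) hc
    exact ⟨S, hS, .inl ⟨J, hJ, hk⟩⟩
  · obtain ⟨S, hS, hk⟩ := key (fun p => p.1 ∈ I) hc
    exact ⟨S, hS, .inr ⟨I, hI, hk⟩⟩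

lemma measurable_predErrorSq {N m T : ℕ} (e : Fin N → Fin m × Fin T)
    {Ahat : (Fin N → ℝ) → Matrix (Fin m) (Fin T) ℝ}
    (hA : ∀ i j, Measurable fun y => Ahat y i j) (A : Matrix (Fin m) (Fin T) ℝ) :
    Measurable fun y => predErrorSq (fun k => pointMask (e k)) (Ahat y) A := by
  simp only [predErrorSq, trace_pointMask_transpose_mul, Matrix.sub_apply]
  exact (Finset.measurable_fun_sum _ fun k _ =>
    ((hA _ _).sub_const _).pow_const 2).const_mul _

lemma one_sub_pow_le_minimaxExceedance {N m T : ℕ} {Ω : Type*} [MeasurableSpace Ω]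
    {P : Measure Ω} [IsProbabilityMeasure P] {v : ℝ≥0} (hv : 0 < v) {ξ : Fin N → Ω → ℝ}
    (hξ : ∀ k, HasLaw (ξ k) (gaussianReal 0 v) P) (hind : iIndepFun ξ P)
    {e : Fin N → Fin m × Fin T} (he : Function.Injective e) {S : Finset (Fin N)}
    {C : Set (Matrix (Fin m) (Fin T) ℝ)} {η t : ℝ} (hη : 0 < η) (hηv : η ^ 2 ≤ v / 40)
    (hC : ∀ ω, signMatrix e S η ω ∈ C) (ht : 32 * (N * t) ≤ S.card * η ^ 2) :
    1 - ENNReal.ofReal (3 / 4) ^ S.card ≤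
      minimaxExceedance P (fun k => pointMask (e k)) ξ C t := by
  refine le_iInf₂ fun Ahat hA => ?_
  set V := ⨆ A ∈ C, obsLaw P (fun k => pointMask (e k)) ξ A
    {y | t < predErrorSq (fun k => pointMask (e k)) (Ahat y) A}
  let D : (Fin N → Bool) → Set (Fin N → ℝ) := fun ω =>
    {y | predErrorSq (fun k => pointMask (e k)) (Ahat y) (signMatrix e S η ω) ≤ t}
  let b : Fin N → Bool → ℝ := fun k c => if k ∈ S then (if c then η else -η) else 0
  have hD : ∀ ω, MeasurableSet (D ω) := fun ω =>
    measurableSet_le (measurable_predErrorSq e hA _) measurable_const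
  have hb : ∀ k c, b k c ^ 2 ≤ v / 40 := by
    intro k c
    simp only [b]
    split_ifs
    · exact hηv
    · simpa using hηv
    · simp only [ne_eq, two_ne_zero, not_false_eq_true, zero_pow]; positivity
  have hnear := sum_pi_gaussianReal_near_le S hv b hb
    (fun y k => decide (0 ≤ Ahat y (e k).1 (e k).2)) D hD (by
      intro ω y hy
      have h1 := card_wrong_sign_le (S := S) (ω := ω) he hη.le (Ahat y)
      have h2 : (N : ℝ) * predErrorSq (fun k => pointMask (e k)) (Ahat y) (signMatrix e S η ω) ≤
          N * t := mul_le_mul_of_nonneg_left hy (Nat.cast_nonneg N)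
      have h3 := le_of_mul_le_mul_right (a := η ^ 2)
        (b := 32 * ((S.filter fun k => ω k ≠ decide (0 ≤ Ahat y (e k).1 (e k).2)).card : ℝ))
        (c := S.card) (by linarith) (by positivity)
      exact_mod_cast h3)
  have hone : ∀ ω, 1 ≤ V + Measure.pi (fun k => gaussianReal (b k (ω k)) v) (D ω) := by
    intro ω
    have hlaw : obsLaw P (fun k => pointMask (e k)) ξ (signMatrix e S η ω) =
        Measure.pi fun k => gaussianReal (b k (ω k)) v := by
      simp only [obsLaw_pointMask e hξ hind, signMatrix_apply_observed he, b]
    have hcompl : (D ω)ᶜ = {y | t <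
        predErrorSq (fun k => pointMask (e k)) (Ahat y) (signMatrix e S η ω)} := by
      ext y; simp [D]
    rw [← prob_add_prob_compl (μ := Measure.pi fun k => gaussianReal (b k (ω k)) v) (hD ω),
      add_comm]
    gcongr
    rw [hcompl, ← hlaw]
    exact le_iSup₂ (f := fun A (_ : A ∈ C) => obsLaw P (fun k => pointMask (e k)) ξ A
      {y | t < predErrorSq (fun k => pointMask (e k)) (Ahat y) A}) _ (hC ω)
  have hsum : (2 : ℝ≥0∞) ^ N * 1 ≤ 2 ^ N * (V + ENNReal.ofReal (3 / 4) ^ S.card) := by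
    have h := Finset.sum_le_sum fun ω (_ : ω ∈ (Finset.univ : Finset (Fin N → Bool))) => hone ω
    rw [Finset.sum_add_distrib] at h
    simp only [Finset.sum_const, Finset.card_univ, Fintype.card_fun, Fintype.card_bool,
      Fintype.card_fin, nsmul_eq_mul, Nat.cast_pow, Nat.cast_ofNat] at h hnear
    rw [mul_add]
    exact h.trans (by gcongr)
  exact tsub_le_iff_right.2
    ((ENNReal.mul_le_mul_iff_right (by positivity) (by finiteness)).1 hsum)

end TraceRegression

theorem theorem7 :
    ∃ β : ℝ → ℝ → ℝ,
      (∀ x α : ℝ, 0 < x → 0 < α → α < 1 / 8 → 0 < β x α) ∧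
      Tendsto (fun q : ℝ × ℝ => β q.1 q.2) (atTop ×ˢ 𝓝[>] (0 : ℝ)) (𝓝 1) ∧
      ∀ (Ω : Type*) [MeasurableSpace Ω] (P : Measure Ω) [IsProbabilityMeasure P]
        (N m T r : ℕ) (σ : ℝ≥0) (ξ : Fin N → Ω → ℝ) (e : Fin N → Fin m × Fin T)
        (κ α δ : ℝ),
        0 < σ →
        (∀ k, HasLaw (ξ k) (gaussianReal 0 (σ ^ 2)) P) →
        iIndepFun ξ P →
        Function.Injective (fun k => TraceRegression.pointMask (e k)) →
        r ≤ min T m →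
        0 < κ → κ ≤ 1 →
        8 ≤ κ * (max m T : ℕ) * r →
        TraceRegression.Dispersed κ r e →
        0 < α → α < 1 / 8 →
        0 < δ →
        α * (σ : ℝ) ^ 2 * Real.log 2 * (κ * (max m T : ℕ) * r + 1) / 4 ≤ δ ^ 2 →
        ENNReal.ofReal (β (κ * (max m T : ℕ)) α) ≤
          TraceRegression.minimaxExceedance P
            (fun k => TraceRegression.pointMask (e k)) ξ
            (TraceRegression.lowRankBall m T r δ)
            ((α * Real.log 2 / 128) * ((σ : ℝ) ^ 2 * κ * r * (max m T : ℕ) / N)) := by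
  refine ⟨fun x _ => 1 - (3 / 4 : ℝ) ^ x, fun x _ hx _ _ => ?_, ?_, ?_⟩
  · exact sub_pos.2 (Real.rpow_lt_one (by norm_num) (by norm_num) hx)
  · have h := (tendsto_rpow_atTop_of_base_lt_one (3 / 4 : ℝ)
      (by norm_num) (by norm_num)).const_sub 1
    rw [sub_zero] at h
    exact h.comp tendsto_fst
  intro Ω _ P _ N m T r σ ξ e κ α δ hσ hξ hind hinj _ hκ _ h8 hdisp hα hα8 hδ hδ2
  have he : Function.Injective e := fun k l hkl => hinj (by simp only [hkl])
  obtain ⟨S, hScard, hS⟩ := hdisp.exists_finset hκ.le he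
  set M : ℝ := ((max m T : ℕ) : ℝ)
  have hM : 0 ≤ M := Nat.cast_nonneg _
  have hr : (1 : ℝ) ≤ r := by
    rcases Nat.eq_zero_or_pos r with rfl | hr
    · norm_num at h8
    · exact_mod_cast hr
  have hσ' : (0 : ℝ) < σ := hσ
  have hlog : 0 < Real.log 2 := Real.log_pos one_lt_two
  have hlog' := Real.log_two_lt_d9
  have hSle : (S.card : ℝ) ≤ κ * M * r + 1 := by
    rw [hScard]; push_cast
    have := Nat.floor_le (a := κ * M * r) (by positivity)
    linarith
  have hleS : κ * M * r ≤ S.card := by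
    rw [hScard]; push_cast
    exact (Nat.lt_floor_add_one _).le
  have hN : (N : ℝ) ≠ 0 := by
    have hN : S.card ≤ N := by simpa using S.card_le_univ
    have : 0 < N := by omega
    positivity
  have hη2 : √(α * σ ^ 2 * Real.log 2 / 4) ^ 2 = α * σ ^ 2 * Real.log 2 / 4 :=
    Real.sq_sqrt (by positivity)
  have hmain := TraceRegression.one_sub_pow_le_minimaxExceedance (v := σ ^ 2) (by positivity)
    hξ hind he (S := S) (C := TraceRegression.lowRankBall m T r δ)
    (η := √(α * σ ^ 2 * Real.log 2 / 4))
    (t := (α * Real.log 2 / 128) * ((σ : ℝ) ^ 2 * κ * r * M / N)) (by positivity)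
    (by
      rw [hη2]; push_cast
      have : α * Real.log 2 ≤ 1 / 10 := by nlinarith
      nlinarith [sq_nonneg (σ : ℝ)])
    (fun ω => TraceRegression.signMatrix_mem_lowRankBall he hS hδ (by
      rw [hη2]
      refine le_trans ?_ hδ2
      have : 0 ≤ α * (σ : ℝ) ^ 2 * Real.log 2 := by positivity
      nlinarith))
    (by
      rw [hη2]
      have : 32 * (N * ((α * Real.log 2 / 128) * ((σ : ℝ) ^ 2 * κ * r * M / N))) =
          κ * M * r * (α * (σ : ℝ) ^ 2 * Real.log 2 / 4) := by
        field_simp; ring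
      rw [this]
      gcongr)
  refine le_trans ?_ hmain
  rw [← ENNReal.ofReal_pow (by norm_num), ← ENNReal.ofReal_one,
    ← ENNReal.ofReal_sub _ (by positivity), ← Real.rpow_natCast]
  refine ENNReal.ofReal_le_ofReal (sub_le_sub_left ?_ _)
  refine Real.rpow_le_rpow_of_exponent_ge (by norm_num) (by norm_num) (le_trans ?_ hleS)
  exact le_mul_of_one_le_right (by positivity) hr
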